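/- There are absolute constants $c_2, c_3 > 0$ such that the following holds. Let $p, r, n$ be natural numbers with $n \ge p$, let $S^*$ be a positive definite and $L^*$ a positive semidefinite real $p\times p$ matrix with $\operatorname{rank} L^* \le r$, and put $\Sigma^* = (S^*+L^*)^{-1}$. Let $X_1,\dots,X_n$ be i.i.d. $\mathcal N(0,\Sigma^*)$ random vectors, $C = \frac1n\sum_{i=1}^n X_iX_i^T$ their sample covariance, $F(L) = -\log\det(S^*+L) + \langle S^*+L, C\rangle$ the negative log-likelihood and $\nabla F(L) = C-(S^*+L)^{-1}$ its gradient. Write $\|\cdot\|_F$ and $\|\cdot\|_2$ for the Frobenius and the spectral norm, $\mathcal P_U$ for the Frobenius-orthogonal projection onto a subspace $U\subseteq\mathbb R^{p\times p}$, and $\mathbb U_k$ for the set of subspaces of $\mathbb R^{p\times p}$ spanned by $k$ atoms $uv^T$ with unit vectors $u,v\in\mathbb R^p$. Then with probability at least $1-2\exp(-p)$ both of the following hold. (a) (EP-LVM) Let $\eta>0$, $L^0 = 0$, and for every $t\ge 0$ let $L^{t+1}$ be a Frobenius-nearest point to $L^t-\eta\nabla F(L^t)$ among the positive semidefinite matrices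 of rank at most $r$. Let $J_t$ be the space of matrices whose columns lie in the span of the column spaces of $L^t$, $L^{t+1}$ and $L^*$. Then for every $t$ $$\|\mathcal P_{J_t}\nabla F(L^*)\|_F \le c_2\,\|\Sigma^*\|_2\sqrt{\frac{rp}{n}}.$$ (b) (AP-LVM) Let $c_{\mathcal T}>1$ and $0<c_{\mathcal H}<1$. Let $\mathcal T:\mathbb R^{p\times p}\to\mathbb U_r$ be a $c_{\mathcal T}$-approximate tail projection, that is, $\|A-\mathcal P_{\mathcal T(A)}A\|_F\le c_{\mathcal T}\|A-A_r\|_F$ for all $A$, and let $\mathcal H:\mathbb R^{p\times p}\to\mathbb U_{2r}$ be a $c_{\mathcal H}$-approximate head projection, that is, $\|\mathcal P_{\mathcal H(A)}A\|_F\ge c_{\mathcal H}\|A_{2r}\|_F$ for all $A$, where $A_k$ denotes a best approximation of $A$ of rank at most $k$ in Frobenius norm. Let $\eta>0$, $L^0=0$ and, for every $t\ge0$, $V_t=\mathcal H(\nabla F(L^t))$, $b_t = L^t-\eta\,\mathcal P_{V_t}\nabla F(L^t)$ and $L^{t+1}=\mathcal P_{\mathcal T(b_t)}\,b_t$. Then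 for every $t$ $$\|\mathcal P_{V_t}\nabla F(L^*)\|_F \le c_3\,\|\Sigma^*\|_2\sqrt{\frac{rp}{n}}.$$ -/

import Mathlib

open MeasureTheory ProbabilityTheory Matrix

noncomputable section

namespace LatentGGM

/-- Real `p × p` matrices. -/
abbrev Mat (p : ℕ) : Type := Matrix (Fin p) (Fin p) ℝ

/-- The matrix space `ℝ^{p × p}` identified, entry by entry, with a Euclidean space; the Euclidean
inner product is the Frobenius inner product of matrices. -/
def vec (p : ℕ) : Mat p ≃ₗ[ℝ] EuclideanSpace ℝ (Fin p × Fin p) :=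
  (LinearEquiv.curry ℝ ℝ (Fin p) (Fin p)).symm ≪≫ₗ
    (WithLp.linearEquiv 2 ℝ (Fin p × Fin p → ℝ)).symm

@[simp] theorem vec_apply {p : ℕ} (A : Mat p) (i j : Fin p) : vec p A (i, j) = A i j := rfl

/-- Frobenius norm. -/
def frobNorm {p : ℕ} (A : Mat p) : ℝ := Real.sqrt (∑ i, ∑ j, A i j ^ 2)

theorem frobNorm_eq_norm_vec {p : ℕ} (A : Mat p) : frobNorm A = ‖vec p A‖ := by
  simp [frobNorm, EuclideanSpace.norm_eq, Fintype.sum_prod_type]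

/-- Frobenius inner product `⟨A, B⟩ = tr(Aᵀ B)`. -/
def frobInner {p : ℕ} (A B : Mat p) : ℝ := (Aᵀ * B).trace

theorem frobInner_eq_inner_vec {p : ℕ} (A B : Mat p) :
    frobInner A B = inner ℝ (vec p A) (vec p B) := by
  simp only [frobInner, Matrix.trace, Matrix.diag, Matrix.mul_apply, Matrix.transpose_apply,
    PiLp.inner_apply, Fintype.sum_prod_type, vec_apply]
  rw [Finset.sum_comm]
  refine Finset.sum_congr rfl fun i _ => Finset.sum_congr rfl fun j _ => ?_
  simp [mul_comm]

/-- Spectral norm: the operator norm for the Euclidean norm on `ℝ^p`. -/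
def specNorm {p : ℕ} (A : Mat p) : ℝ := ‖Matrix.toEuclideanCLM (𝕜 := ℝ) A‖

/-- `P_U A`: the Frobenius-orthogonal projection of `A` onto the subspace `U ⊆ ℝ^{p × p}`. -/
def proj {p : ℕ} (U : Submodule ℝ (Mat p)) (A : Mat p) : Mat p :=
  (vec p).symm ((U.map (vec p).toLinearMap).starProjection (vec p A))

/-- The sample covariance matrix `C = (1/n) ∑ i, x i (x i)ᵀ`. -/
def sampleCov {p n : ℕ} (x : Fin n → EuclideanSpace ℝ (Fin p)) : Mat p :=
  (1 / (n : ℝ)) • ∑ i, Matrix.vecMulVec (fun a => x i a) (fun b => x i b)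

/-- The negative log-likelihood `F(L) = - log det (S + L) + ⟨S + L, C⟩`. -/
def objective {p : ℕ} (S C L : Mat p) : ℝ :=
  -Real.log (S + L).det + frobInner (S + L) C

/-- The gradient `∇F(L) = -(S + L)⁻¹ + C`. -/
def grad {p : ℕ} (S C L : Mat p) : Mat p := -(S + L)⁻¹ + C

/-- Where `S + L` is positive definite, `grad S C L` represents the derivative of the objective
in every direction through the Frobenius inner product. -/
theorem hasDerivAt_objective {p : ℕ} (S C L H : Mat p) (h : (S + L).PosDef) :
    HasDerivAt (fun s : ℝ => objective S C (L + s • H)) (frobInner (grad S C L) H) 0 := by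
  have hdet : (S + L).det ≠ 0 := h.det_pos.ne'
  have hu : IsUnit (S + L).det := isUnit_iff_ne_zero.2 hdet
  have hfac : ∀ s : ℝ, (S + (L + s • H)).det
      = (S + L).det * (1 + s • ((S + L)⁻¹ * H)).det := by
    intro s
    rw [← Matrix.det_mul, Matrix.mul_add, Matrix.mul_one, Matrix.mul_smul, ← Matrix.mul_assoc,
      Matrix.mul_nonsing_inv _ hu, Matrix.one_mul, add_assoc]
  have hd : HasDerivAt (fun s : ℝ => (1 + s • ((S + L)⁻¹ * H)).det)
      ((S + L)⁻¹ * H).trace 0 := by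
    have h1 := (Matrix.det (1 + (Polynomial.X : Polynomial ℝ) •
      ((S + L)⁻¹ * H).map Polynomial.C)).hasDerivAt (0 : ℝ)
    rw [Matrix.derivative_det_one_add_X_smul] at h1
    refine h1.congr_of_eventuallyEq (Filter.Eventually.of_forall fun s => ?_)
    change _ = (Polynomial.evalRingHom s) (Matrix.det _)
    rw [RingHom.map_det]
    refine congrArg Matrix.det (Matrix.ext fun i j => ?_)
    simp [Matrix.one_apply, apply_ite, -Matrix.map_mul]
    exact mul_comm _ _
  have hlog : HasDerivAt (fun s : ℝ => Real.log (S + (L + s • H)).det)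
      ((S + L)⁻¹ * H).trace 0 := by
    simp only [hfac]
    have h2 := (hd.const_mul (S + L).det).log (by simpa using hdet)
    convert h2 using 1
    simp [hdet]
  have hlin : HasDerivAt (fun s : ℝ => frobInner (S + (L + s • H)) C) (frobInner H C) 0 := by
    have h3 : (fun s : ℝ => frobInner (S + (L + s • H)) C)
        = fun s => frobInner (S + L) C + s * frobInner H C := by
      funext s
      simp [frobInner, Matrix.transpose_add, Matrix.add_mul, add_assoc]
    rw [h3]
    simpa using ((hasDerivAt_id (0 : ℝ)).mul_const (frobInner H C)).const_add
      (frobInner (S + L) C)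
  have hsymm : ((S + L)⁻¹)ᵀ = (S + L)⁻¹ := by
    have := h.isHermitian.inv
    simpa [Matrix.IsHermitian, Matrix.conjTranspose_eq_transpose_of_trivial] using this
  have hC : frobInner H C = frobInner C H := by
    rw [frobInner_eq_inner_vec, frobInner_eq_inner_vec, real_inner_comm]
  have := hlog.neg.add hlin
  have he : -((S + L)⁻¹ * H).trace + frobInner H C = frobInner (grad S C L) H := by
    rw [hC]
    simp [frobInner, grad, Matrix.transpose_add, Matrix.transpose_neg, hsymm, Matrix.add_mul]
  rw [he] at this
  exact this

/-- Column space of a matrix. -/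
def colSpace {p : ℕ} (A : Mat p) : Submodule ℝ (Fin p → ℝ) := LinearMap.range (Matrix.mulVecLin A)

/-- The subspace of `ℝ^{p × p}` of all matrices whose columns lie in `J ⊆ ℝ^p`. The projection onto
it is left multiplication by the orthogonal projector of `ℝ^p` onto `J`. -/
def matricesOver {p : ℕ} (J : Submodule ℝ (Fin p → ℝ)) : Submodule ℝ (Mat p) where
  carrier := {A | ∀ j, (fun i => A i j) ∈ J}
  zero_mem' := fun _ => J.zero_mem
  add_mem' := fun hA hB j => J.add_mem (hA j) (hB j)
  smul_mem' := fun c _ hA j => J.smul_mem c (hA j)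

/-- `B` is a best approximation of `A` of rank at most `r` in Frobenius norm (`B = A_r`). -/
def IsBestRankApprox {p : ℕ} (r : ℕ) (A B : Mat p) : Prop :=
  B.rank ≤ r ∧ ∀ B' : Mat p, B'.rank ≤ r → frobNorm (A - B) ≤ frobNorm (A - B')

/-- `B = P_r^+(A)`: a nearest point to `A`, in Frobenius norm, among the positive semidefinite
matrices of rank at most `r`. -/
def IsPSDRankProj {p : ℕ} (r : ℕ) (A B : Mat p) : Prop :=
  (B.PosSemidef ∧ B.rank ≤ r) ∧
    ∀ B' : Mat p, B'.PosSemidef → B'.rank ≤ r → frobNorm (A - B) ≤ frobNorm (A - B')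

/-- `U ∈ 𝕌_r`: the subspace `U` of `ℝ^{p × p}` is spanned by `r` atoms `u vᵀ` with unit vectors
`u, v ∈ ℝ^p`. -/
def IsRankSubspace {p : ℕ} (r : ℕ) (U : Submodule ℝ (Mat p)) : Prop :=
  ∃ u v : Fin r → Fin p → ℝ, (∀ k, u k ⬝ᵥ u k = 1 ∧ v k ⬝ᵥ v k = 1) ∧
    U = Submodule.span ℝ (Set.range fun k => Matrix.vecMulVec (u k) (v k))

/-- `T : ℝ^{p × p} → 𝕌_r` is a `c`-approximate tail projection. -/
def IsApproxTail {p : ℕ} (c : ℝ) (r : ℕ) (T : Mat p → Submodule ℝ (Mat p)) : Prop :=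
  ∀ A : Mat p, IsRankSubspace r (T A) ∧
    ∀ B : Mat p, IsBestRankApprox r A B → frobNorm (A - proj (T A) A) ≤ c * frobNorm (A - B)

/-- `H : ℝ^{p × p} → 𝕌_r` is a `c`-approximate head projection. -/
def IsApproxHead {p : ℕ} (c : ℝ) (r : ℕ) (H : Mat p → Submodule ℝ (Mat p)) : Prop :=
  ∀ A : Mat p, IsRankSubspace r (H A) ∧
    ∀ B : Mat p, IsBestRankApprox r A B → c * frobNorm B ≤ frobNorm (proj (H A) A)

/-- `L 0, L 1, …` are iterates of the exact-projection method with step size `η` and rank `r`: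
`L^0 = 0`, `L^{t+1} = P_r^+(L^t - η ∇F(L^t))`. -/
def IsEPRun {p : ℕ} (S C : Mat p) (r : ℕ) (η : ℝ) (L : ℕ → Mat p) : Prop :=
  L 0 = 0 ∧ ∀ t, IsPSDRankProj r (L t - η • grad S C (L t)) (L (t + 1))

/-- `J_t`: the subspace attached to the span of the column spaces of `L^t`, `L^{t+1}` and `L*`. -/
def epSubspace {p : ℕ} (Lstar : Mat p) (L : ℕ → Mat p) (t : ℕ) : Submodule ℝ (Mat p) :=
  matricesOver (colSpace (L t) ⊔ colSpace (L (t + 1)) ⊔ colSpace Lstar)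

/-- `V_t`: the subspace returned by the head projection applied to the gradient at `L^t`. -/
def apSubspace {p : ℕ} (S C : Mat p) (H : Mat p → Submodule ℝ (Mat p)) (L : ℕ → Mat p) (t : ℕ) :
    Submodule ℝ (Mat p) :=
  H (grad S C (L t))

/-- One step of the approximate-projection method: with the subspaces `V = H(∇F(L))` and
`W = T(b)`, where `b = L - η P_V ∇F(L)`, the next iterate is `P_W b`. -/
def apStep {p : ℕ} (S C : Mat p) (η : ℝ) (T H : Mat p → Submodule ℝ (Mat p)) (L : Mat p) : Mat p :=
  let b : Mat p := L - η • proj (H (grad S C L)) (grad S C L)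
  proj (T b) b

/-- `L 0, L 1, …` are the iterates of the approximate-projection method with step size `η`:
`L^0 = 0`, `L^{t+1} = T(L^t - η H(∇F(L^t)))`. -/
def IsAPRun {p : ℕ} (S C : Mat p) (η : ℝ) (T H : Mat p → Submodule ℝ (Mat p)) (L : ℕ → Mat p) :
    Prop :=
  L 0 = 0 ∧ ∀ t, L (t + 1) = apStep S C η T H (L t)

end LatentGGM

end

/-!
At `L = L*` the gradient is `C - Σ*`, the error of the sample covariance, and this error does not
depend on the iterates. Everything therefore happens on the single event on which
`‖C - Σ*‖₂ ≤ 512 ‖Σ*‖₂ √(p/n)`.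

*On the event.* The subspaces in question depend on the data, but all of their elements have low
rank: at most `3r` for `J_t` and at most `2r` for a span of `2r` atoms, whether or not the atoms are
orthogonal. If every element of `U` has rank at most `k`, then `P_U G` itself has, and
`‖P_U G‖_F² = ⟨P_U G, G⟩ ≤ ‖P_U G‖_F √k ‖G‖₂` by `frobInner_le_of_rank`; this is
`frobNorm_proj_le`.

*Probability of the event.* For a unit vector `c` the numbers `⟨c, X_i⟩` are independent centred
Gaussians of variance `cᵀ Σ* c ≤ ‖Σ*‖₂`, so Chernoff's bound for their squares
(`measureReal_signed_sum_sq_ge_le`) controls `cᵀ (C - Σ*) c`; the hypothesis `p ≤ n` keeps the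
deviation in the sub-Gaussian range. A union bound over a net of `5 ^ p` unit vectors
(`exists_sphere_net`), on which the norm of a symmetric operator can be read off up to the factor
`32` (`norm_le_of_sphere_net`), gives `measureReal_specNorm_sampleCov_sub_gt_le`.
-/

namespace LatentGGM

/-! ### Operator norm on a net of the unit sphere -/

/-- A maximal `1/2`-separated subset of the unit sphere is a `1/2`-net; doubling it gives a
`1`-separated subset of the ball of radius `2`, whose cardinality Mathlib bounds by a volume
argument. -/
theorem exists_sphere_net (E : Type*) [NormedAddCommGroup E] [NormedSpace ℝ E]
    [FiniteDimensional ℝ E] :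
    ∃ s : Finset E, s.card ≤ 5 ^ Module.finrank ℝ E ∧ (∀ c ∈ s, ‖c‖ = 1) ∧
      ∀ x : E, ‖x‖ = 1 → ∃ c ∈ s, ‖x - c‖ ≤ 1 / 2 := by
  classical
  let P : ℕ → Prop := fun k => ∃ s : Finset E, s.card = k ∧ (∀ c ∈ s, ‖c‖ = 1) ∧
    ∀ c ∈ s, ∀ d ∈ s, c ≠ d → 1 / 2 ≤ ‖c - d‖
  have hP : ∀ k, P k → k ≤ 5 ^ Module.finrank ℝ E := by
    rintro k ⟨s, rfl, h1, h2⟩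
    have hinj : Function.Injective fun c : E => (2 : ℝ) • c :=
      smul_right_injective E two_ne_zero
    rw [← Finset.card_image_of_injective s hinj]
    refine Besicovitch.card_le_of_separated _ ?_ ?_
    · simp only [Finset.mem_image]
      rintro _ ⟨c, hc, rfl⟩
      simp [norm_smul, h1 c hc]
    · simp only [Finset.mem_image]
      rintro _ ⟨c, hc, rfl⟩ _ ⟨d, hd, rfl⟩ hcd
      have := h2 c hc d hd fun h => hcd (by rw [h])
      rw [← smul_sub, norm_smul, Real.norm_two]
      linarith
  have hP0 : P 0 := ⟨∅, by simp⟩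
  obtain ⟨s, hcard, h1, h2⟩ := Nat.findGreatest_spec (P := P) (Nat.zero_le (5 ^ Module.finrank ℝ E)) hP0
  refine ⟨s, hP _ ⟨s, rfl, h1, h2⟩, h1, fun x hx => ?_⟩
  by_contra! hfar
  have hxs : x ∉ s := fun hxs => by
    have := hfar x hxs
    rw [sub_self, norm_zero] at this
    norm_num at this
  have hP' : P (s.card + 1) := by
    refine ⟨insert x s, Finset.card_insert_of_notMem hxs, ?_, ?_⟩
    · simpa [hx] using h1
    · intro c hc d hd hcd
      rw [Finset.mem_insert] at hc hd
      rcases hc with rfl | hc <;> rcases hd with rfl | hd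
      · exact absurd rfl hcd
      · exact (hfar d hd).le
      · rw [norm_sub_rev]
        exact (hfar c hc).le
      · exact h2 c hc d hd hcd
  exact absurd (Nat.le_findGreatest (hP _ hP') hP') (by omega)

/-- For unit vectors `x`, `c` at distance `d ≤ 1/2` the values of the quadratic form of a symmetric
`T` differ by `⟪T (x + c), x - c⟫`, and `‖x + c‖ ‖x - c‖ = √(4 - d²) d < 1`. So a `1/2`-net is fine
enough, which a bound by `2 d ‖T‖` would not show. -/
theorem norm_le_of_sphere_net {E : Type*} [NormedAddCommGroup E] [InnerProductSpace ℝ E]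
    {T : E →L[ℝ] E} (hT : (T : E →ₗ[ℝ] E).IsSymmetric) {s : Finset E} (hs : ∀ c ∈ s, ‖c‖ = 1)
    (hnet : ∀ x : E, ‖x‖ = 1 → ∃ c ∈ s, ‖x - c‖ ≤ 1 / 2) {M : ℝ} (hM : 0 ≤ M)
    (hTM : ∀ c ∈ s, |inner ℝ (T c) c| ≤ M) : ‖T‖ ≤ 32 * M := by
  have key : ∀ x : E, ‖x‖ = 1 → |inner ℝ (T x) x| ≤ 31 / 32 * ‖T‖ + M := by
    intro x hx
    obtain ⟨c, hc, hxc⟩ := hnet x hx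
    have hsymm : inner ℝ (T x) c = inner ℝ (T c) x := by
      rw [real_inner_comm x (T c)]; exact hT x c
    have hdiff : inner ℝ (T x) x - inner ℝ (T c) c = inner ℝ (T (x + c)) (x - c) := by
      simp only [map_add, inner_add_left, inner_sub_right, hsymm]
      ring
    have hpar : ‖x + c‖ ^ 2 + ‖x - c‖ ^ 2 = 4 := by
      have := parallelogram_law_with_norm ℝ x c
      rw [hx, hs c hc] at this
      nlinarith
    have hprod : ‖x + c‖ * ‖x - c‖ ≤ 31 / 32 := by
      refine abs_le_of_sq_le_sq' ?_ (by norm_num) |>.2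
      have h0 : ‖x - c‖ ^ 2 ≤ 1 / 4 := by nlinarith [norm_nonneg (x - c)]
      have h1 : ‖x + c‖ ^ 2 = 4 - ‖x - c‖ ^ 2 := by linarith
      rw [mul_pow, h1]
      nlinarith [sq_nonneg (‖x - c‖ ^ 2)]
    have hbd : |inner ℝ (T (x + c)) (x - c)| ≤ 31 / 32 * ‖T‖ := calc
      |inner ℝ (T (x + c)) (x - c)| ≤ ‖T (x + c)‖ * ‖x - c‖ := abs_real_inner_le_norm _ _
      _ ≤ ‖T‖ * ‖x + c‖ * ‖x - c‖ := by gcongr; exact T.le_opNorm _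
      _ = ‖T‖ * (‖x + c‖ * ‖x - c‖) := mul_assoc _ _ _
      _ ≤ ‖T‖ * (31 / 32) := by gcongr
      _ = 31 / 32 * ‖T‖ := mul_comm _ _
    rw [← hdiff] at hbd
    have h3 := abs_sub_abs_le_abs_sub (inner ℝ (T x) x) (inner ℝ (T c) c)
    linarith [hTM c hc]
  have hsup : ‖T‖ ≤ 31 / 32 * ‖T‖ + M := by
    conv_lhs => rw [T.norm_eq_iSup_rayleighQuotient hT]
    refine ciSup_le fun x => ?_
    rcases eq_or_ne x 0 with rfl | hx
    · rw [T.rayleighQuotient_apply_zero, abs_zero]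
      positivity
    · have hc : (‖x‖⁻¹ : ℝ) ≠ 0 := by simpa using hx
      rw [← T.rayleigh_smul x hc]
      have hu : ‖(‖x‖⁻¹ : ℝ) • x‖ = 1 := norm_smul_inv_norm (𝕜 := ℝ) hx
      have := key _ hu
      simpa [ContinuousLinearMap.rayleighQuotient, ContinuousLinearMap.reApplyInnerSelf_apply, hu]
        using this
  linarith

/-! ### Projections onto spaces of matrices of low rank -/

theorem toEuclideanCLM_basisFun {p : ℕ} (A : Mat p) (i j : Fin p) :
    toEuclideanCLM (𝕜 := ℝ) A (EuclideanSpace.basisFun (Fin p) ℝ j) i = A i j := by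
  simp

theorem frobNorm_sq_eq_sum_norm_sq {p : ℕ} (A : Mat p) :
    frobNorm A ^ 2 =
      ∑ j, ‖toEuclideanCLM (𝕜 := ℝ) A (EuclideanSpace.basisFun (Fin p) ℝ j)‖ ^ 2 := by
  rw [frobNorm, Real.sq_sqrt (by positivity), Finset.sum_comm]
  simp only [EuclideanSpace.norm_sq_eq, toEuclideanCLM_basisFun, Real.norm_eq_abs, sq_abs]

theorem frobInner_eq_sum_inner {p : ℕ} (A B : Mat p) :
    frobInner A B =
      ∑ j, inner ℝ (toEuclideanCLM (𝕜 := ℝ) A (EuclideanSpace.basisFun (Fin p) ℝ j))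
        (toEuclideanCLM (𝕜 := ℝ) B (EuclideanSpace.basisFun (Fin p) ℝ j)) := by
  simp only [PiLp.inner_apply, toEuclideanCLM_basisFun, frobInner, Matrix.trace, Matrix.diag,
    Matrix.mul_apply, Matrix.transpose_apply]
  simp [mul_comm]

theorem finrank_range_toEuclideanCLM {p : ℕ} (A : Mat p) :
    Module.finrank ℝ (LinearMap.range (toEuclideanCLM (𝕜 := ℝ) A).toLinearMap) = A.rank := by
  have h := A.rank_eq_finrank_range_toLin (EuclideanSpace.basisFun (Fin p) ℝ).toBasis
    (EuclideanSpace.basisFun (Fin p) ℝ).toBasis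
  rw [h]
  congr 2

/-- Duality between the spectral norm and the nuclear norm, with the nuclear norm of `A` bounded by
`√(rank A) ‖A‖_F`: only the component of `B` along the column space of `A` matters, and its
Frobenius norm is computed in an orthonormal basis of that space. -/
theorem frobInner_le_of_rank {p : ℕ} (A B : Mat p) :
    frobInner A B ≤ frobNorm A * (Real.sqrt A.rank * specNorm B) := by
  set TA := toEuclideanCLM (𝕜 := ℝ) A
  set TB := toEuclideanCLM (𝕜 := ℝ) B
  set e := EuclideanSpace.basisFun (Fin p) ℝ
  set W := LinearMap.range TA.toLinearMap with hW
  let b := stdOrthonormalBasis ℝ W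
  have hproj : ∀ j, inner ℝ (TA (e j)) (TB (e j))
      = inner ℝ (TA (e j)) (W.starProjection (TB (e j))) := by
    intro j
    rw [← W.inner_starProjection_left_eq_right]
    rw [W.starProjection_eq_self_iff.2 (show TA (e j) ∈ W from ⟨e j, rfl⟩)]
  have hnorm : ∑ j, ‖W.starProjection (TB (e j))‖ ^ 2 ≤ A.rank * ‖TB‖ ^ 2 := by
    have h1 : ∀ j, ‖W.starProjection (TB (e j))‖ ^ 2
        = ∑ k, inner ℝ (e j)
          (ContinuousLinearMap.adjoint TB (b k : EuclideanSpace ℝ (Fin p))) ^ 2 := by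
      intro j
      rw [W.starProjection_apply, ← Submodule.coe_norm, ← b.sum_sq_inner_right]
      refine Finset.sum_congr rfl fun k _ => ?_
      rw [ContinuousLinearMap.adjoint_inner_right, real_inner_comm, Submodule.coe_inner,
        ← W.starProjection_apply, W.inner_starProjection_left_eq_right,
        W.starProjection_eq_self_iff.2 (b k).2]
    simp only [h1]
    rw [Finset.sum_comm]
    simp only [e.sum_sq_inner_right]
    calc ∑ k, ‖ContinuousLinearMap.adjoint TB (b k : EuclideanSpace ℝ (Fin p))‖ ^ 2
        ≤ ∑ _k : Fin (Module.finrank ℝ W), ‖TB‖ ^ 2 := by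
          refine Finset.sum_le_sum fun k _ => ?_
          gcongr
          have h2 := (ContinuousLinearMap.adjoint TB).le_opNorm (b k : EuclideanSpace ℝ (Fin p))
          rwa [LinearIsometryEquiv.norm_map, ← Submodule.coe_norm, b.orthonormal.1 k, mul_one] at h2
      _ = A.rank * ‖TB‖ ^ 2 := by
          rw [Finset.sum_const, Finset.card_univ, Fintype.card_fin, nsmul_eq_mul, hW,
            finrank_range_toEuclideanCLM]
  calc frobInner A B = ∑ j, inner ℝ (TA (e j)) (W.starProjection (TB (e j))) := by
        rw [frobInner_eq_sum_inner]
        exact Finset.sum_congr rfl fun j _ => hproj j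
    _ ≤ ∑ j, ‖TA (e j)‖ * ‖W.starProjection (TB (e j))‖ :=
        Finset.sum_le_sum fun j _ => real_inner_le_norm _ _
    _ ≤ Real.sqrt (∑ j, ‖TA (e j)‖ ^ 2) * Real.sqrt (∑ j, ‖W.starProjection (TB (e j))‖ ^ 2) :=
        Real.sum_mul_le_sqrt_mul_sqrt _ _ _
    _ ≤ frobNorm A * (Real.sqrt A.rank * specNorm B) := by
        rw [← frobNorm_sq_eq_sum_norm_sq, Real.sqrt_sq (show 0 ≤ frobNorm A from Real.sqrt_nonneg _)]
        refine mul_le_mul_of_nonneg_left ?_ (Real.sqrt_nonneg _)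
        refine (Real.sqrt_le_sqrt hnorm).trans_eq ?_
        rw [Real.sqrt_mul (Nat.cast_nonneg _), Real.sqrt_sq (norm_nonneg _), specNorm]

theorem proj_mem {p : ℕ} (U : Submodule ℝ (Mat p)) (G : Mat p) : proj U G ∈ U := by
  obtain ⟨M, hM, h⟩ := (U.map (vec p).toLinearMap).starProjection_apply_mem (vec p G)
  rw [proj, ← h]
  simpa using hM

theorem frobNorm_proj_sq {p : ℕ} (U : Submodule ℝ (Mat p)) (G : Mat p) :
    frobNorm (proj U G) ^ 2 = frobInner (proj U G) G := by
  rw [frobNorm_eq_norm_vec, frobInner_eq_inner_vec, proj, LinearEquiv.apply_symm_apply,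
    ← real_inner_self_eq_norm_sq]
  set V := U.map (vec p).toLinearMap
  conv_rhs => rw [← V.starProjection_eq_self_iff.2 (V.starProjection_apply_mem (vec p G)),
    V.inner_starProjection_left_eq_right]

theorem frobNorm_proj_le {p k : ℕ} {U : Submodule ℝ (Mat p)} (hU : ∀ M ∈ U, M.rank ≤ k)
    (G : Mat p) : frobNorm (proj U G) ≤ Real.sqrt k * specNorm G := by
  have h0 : 0 ≤ frobNorm (proj U G) := Real.sqrt_nonneg _
  have hG : 0 ≤ specNorm G := norm_nonneg _
  have h1 : frobNorm (proj U G) * frobNorm (proj U G)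
      ≤ frobNorm (proj U G) * (Real.sqrt k * specNorm G) := by
    rw [← sq, frobNorm_proj_sq]
    refine (frobInner_le_of_rank _ _).trans ?_
    have : ((proj U G).rank : ℝ) ≤ k := by exact_mod_cast hU _ (proj_mem U G)
    gcongr
  rcases h0.eq_or_lt with h | h
  · rw [← h]; positivity
  · exact le_of_mul_le_mul_left h1 h

theorem rank_le_of_mem_matricesOver {p : ℕ} {J : Submodule ℝ (Fin p → ℝ)} {M : Mat p}
    (hM : M ∈ matricesOver J) : M.rank ≤ Module.finrank ℝ J := by
  rw [Matrix.rank_eq_finrank_span_cols]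
  refine Submodule.finrank_mono (Submodule.span_le.2 ?_)
  rintro _ ⟨j, rfl⟩
  exact hM j

theorem rank_le_of_mem_epSubspace {p r : ℕ} {Lstar : Mat p} {L : ℕ → Mat p}
    (hstar : Lstar.rank ≤ r) (hL : ∀ t, (L t).rank ≤ r) (t : ℕ) {M : Mat p}
    (hM : M ∈ epSubspace Lstar L t) : M.rank ≤ 3 * r := by
  refine (rank_le_of_mem_matricesOver hM).trans ?_
  have hrank : ∀ A : Mat p, Module.finrank ℝ (colSpace A) = A.rank := fun _ => rfl
  have h1 := Submodule.finrank_add_le_finrank_add_finrank (colSpace (L t)) (colSpace (L (t + 1)))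
  have h2 := Submodule.finrank_add_le_finrank_add_finrank
    (colSpace (L t) ⊔ colSpace (L (t + 1))) (colSpace Lstar)
  rw [hrank] at h1 h2
  rw [hrank] at h1
  have := hL t
  have := hL (t + 1)
  omega

theorem IsEPRun.rank_le {p : ℕ} {S C : Mat p} {r : ℕ} {η : ℝ} {L : ℕ → Mat p}
    (h : IsEPRun S C r η L) (t : ℕ) : (L t).rank ≤ r := by
  cases t with
  | zero => simp [h.1]
  | succ t => exact (h.2 t).1.2

theorem IsRankSubspace.rank_le {p k : ℕ} {U : Submodule ℝ (Mat p)} (hU : IsRankSubspace k U)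
    {M : Mat p} (hM : M ∈ U) : M.rank ≤ k := by
  obtain ⟨u, v, -, rfl⟩ := hU
  have hle : Submodule.span ℝ (Set.range fun k => Matrix.vecMulVec (u k) (v k))
      ≤ matricesOver (Submodule.span ℝ (Set.range u)) := by
    rw [Submodule.span_le]
    rintro _ ⟨i, rfl⟩ j
    have : (fun a => Matrix.vecMulVec (u i) (v i) a j) = v i j • u i := by
      ext a; simp [Matrix.vecMulVec_apply, mul_comm]
    rw [this]
    exact Submodule.smul_mem _ _ (Submodule.subset_span ⟨i, rfl⟩)
  refine (rank_le_of_mem_matricesOver (hle hM)).trans ?_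
  simpa [Set.finrank] using finrank_range_le_card (R := ℝ) u

/-! ### Tail bound for sums of squared Gaussian variables -/

theorem inv_sqrt_one_sub_le {y : ℝ} (hy : |y| ≤ 1 / 2) :
    (Real.sqrt (1 - y))⁻¹ ≤ Real.exp (y / 2 + y ^ 2 / 2) := by
  obtain ⟨h1, h2⟩ := abs_le.1 hy
  have hpos : 0 < 1 - y := by linarith
  have key : 1 ≤ Real.exp (y + y ^ 2) * (1 - y) := by
    rcases le_total y 0 with h | h
    · have := Real.add_one_le_exp (y + y ^ 2)
      calc (1 : ℝ) ≤ (y + y ^ 2 + 1) * (1 - y) := by nlinarith [pow_nonneg (neg_nonneg.2 h) 3]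
        _ ≤ _ := by gcongr
    · have := Real.quadratic_le_exp_of_nonneg (show 0 ≤ y + y ^ 2 by positivity)
      calc (1 : ℝ) ≤ (1 + (y + y ^ 2) + (y + y ^ 2) ^ 2 / 2) * (1 - y) := by
            have : 0 ≤ y ^ 2 * (1 - 2 * y) := by
              have : 0 ≤ 1 - 2 * y := by linarith
              positivity
            have h3 : 0 ≤ y ^ 3 := by positivity
            have h4 : 0 ≤ y ^ 3 * (1 - 2 * y) := by
              have : 0 ≤ 1 - 2 * y := by linarith
              positivity
            have h5 : 0 ≤ y ^ 4 * (1 - 2 * y) := by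
              have : 0 ≤ 1 - 2 * y := by linarith
              positivity
            nlinarith
        _ ≤ _ := by gcongr
  have hsq : Real.exp (y / 2 + y ^ 2 / 2) = Real.sqrt (Real.exp (y + y ^ 2)) := by
    rw [Real.sqrt_eq_rpow, ← Real.exp_mul]
    congr 1
    ring
  rw [hsq, ← Real.sqrt_inv]
  exact Real.sqrt_le_sqrt ((inv_le_iff_one_le_mul₀ hpos).2 key)

/-- A centred squared Gaussian variable is sub-exponential. The right-hand side is the second order
term of its cumulant generating function, doubled. -/
theorem integrable_and_integral_exp_sq_sub_le (s : NNReal) {l : ℝ} (hl : |2 * l * s| ≤ 1 / 2) :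
    Integrable (fun x : ℝ => Real.exp (l * (x ^ 2 - s))) (gaussianReal 0 s) ∧
      ∫ x, Real.exp (l * (x ^ 2 - s)) ∂(gaussianReal 0 s) ≤ Real.exp (2 * l ^ 2 * s ^ 2) := by
  rcases eq_or_ne s 0 with rfl | hs
  · rw [gaussianReal_zero_var]
    refine ⟨integrable_dirac (by simp), ?_⟩
    simp
  have hs0 : (0 : ℝ) < s := by exact_mod_cast pos_iff_ne_zero.2 hs
  obtain ⟨h1, h2⟩ := abs_le.1 hl
  have hy : 0 < 1 - 2 * l * s := by linarith
  set b : ℝ := (1 - 2 * l * s) / (2 * s) with hb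
  have hb0 : 0 < b := by positivity
  have hfun : ∀ x : ℝ, gaussianPDFReal 0 s x • Real.exp (l * (x ^ 2 - s))
      = ((Real.sqrt (2 * Real.pi * s))⁻¹ * Real.exp (-(l * s))) * Real.exp (-b * x ^ 2) := by
    intro x
    rw [gaussianPDFReal, smul_eq_mul, mul_assoc _ (Real.exp _), mul_assoc _ (Real.exp _),
      ← Real.exp_add, ← Real.exp_add]
    congr 2
    rw [hb]
    field_simp
    ring
  constructor
  · rw [gaussianReal_of_var_ne_zero _ hs, integrable_withDensity_iff_integrable_smul₀'
      (by fun_prop) (by simp [gaussianPDF])]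
    have hint := (integrable_exp_neg_mul_sq hb0).const_mul
      ((Real.sqrt (2 * Real.pi * s))⁻¹ * Real.exp (-(l * s)))
    refine hint.congr (Filter.Eventually.of_forall fun x => ?_)
    simp only [toReal_gaussianPDF]
    exact (hfun x).symm
  · rw [integral_gaussianReal_eq_integral_smul hs]
    simp only [hfun]
    rw [integral_const_mul, integral_gaussian]
    have hsqrt : (Real.sqrt (2 * Real.pi * s))⁻¹ * Real.sqrt (Real.pi / b)
        = (Real.sqrt (1 - 2 * l * s))⁻¹ := by
      rw [← Real.sqrt_inv, ← Real.sqrt_inv, ← Real.sqrt_mul (by positivity), hb]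
      congr 1
      field_simp
    calc (Real.sqrt (2 * Real.pi * s))⁻¹ * Real.exp (-(l * s)) * Real.sqrt (Real.pi / b)
        = (Real.sqrt (1 - 2 * l * s))⁻¹ * Real.exp (-(l * s)) := by rw [← hsqrt]; ring
      _ ≤ Real.exp ((2 * l * s) / 2 + (2 * l * s) ^ 2 / 2) * Real.exp (-(l * s)) := by
          gcongr
          exact inv_sqrt_one_sub_le hl
      _ = Real.exp (2 * l ^ 2 * s ^ 2) := by
          rw [← Real.exp_add]
          congr 1
          ring

/-- Chernoff's bound for the upper (`ε = 1`) and the lower (`ε = -1`) tail of the sample variance.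
The exponent `√(p/n) / (4 σ)` is admissible because `p ≤ n`, and gives the rate
`16 p / 4 - p / 8 ≥ 3 p`. -/
theorem measureReal_signed_sum_sq_ge_le {Ω : Type*} [MeasurableSpace Ω] {μ : Measure Ω}
    [IsProbabilityMeasure μ] {p n : ℕ} (hp : 0 < p) (hpn : p ≤ n) {Y : Fin n → Ω → ℝ}
    (hind : iIndepFun Y μ) {s : NNReal} (hY : ∀ i, HasLaw (Y i) (gaussianReal 0 s) μ) {σ : ℝ}
    (hσ : 0 < σ) (hs : s ≤ σ) {ε : ℝ} (hε : |ε| = 1) :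
    μ.real {ω | 16 * σ * Real.sqrt (p / n) * n ≤ ε * ∑ i, (Y i ω ^ 2 - s)}
      ≤ Real.exp (-(3 * p)) := by
  have hn : (0 : ℝ) < n := by exact_mod_cast hp.trans_le hpn
  set q : ℝ := Real.sqrt (p / n) with hq
  have hq0 : 0 ≤ q := Real.sqrt_nonneg _
  have hq2 : q ^ 2 * n = p := by
    rw [hq, Real.sq_sqrt (by positivity)]
    field_simp
  have hq1 : q ≤ 1 := by
    refine Real.sqrt_le_one.2 ((div_le_one hn).2 ?_)
    exact_mod_cast hpn
  set l : ℝ := q / (4 * σ) with hl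
  have hl0 : 0 ≤ l := by positivity
  have hlσ : l * σ = q / 4 := by rw [hl]; field_simp
  have hls : l * s ≤ q / 4 := hlσ ▸ mul_le_mul_of_nonneg_left hs hl0
  have hls0 : 0 ≤ l * s := by positivity
  have hεsq : ε ^ 2 = 1 := by rw [← sq_abs, hε, one_pow]
  have hsmall : |2 * (l * ε) * s| ≤ 1 / 2 := by
    rw [show 2 * (l * ε) * s = 2 * (l * s) * ε by ring, abs_mul, hε, mul_one,
      abs_of_nonneg (by positivity)]
    linarith
  obtain ⟨hint, hmgf⟩ := integrable_and_integral_exp_sq_sub_le s hsmall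
  let Z : Fin n → Ω → ℝ := fun i ω => ε * (Y i ω ^ 2 - s)
  have hZm : ∀ i, AEMeasurable (Z i) μ := fun i =>
    (((hY i).aemeasurable.pow_const 2).sub_const _).const_mul _
  have hZind : iIndepFun Z μ :=
    hind.comp (fun _ x => ε * (x ^ 2 - s)) fun _ => by fun_prop
  have hexp : ∀ i ω, Real.exp (l * Z i ω) = Real.exp (l * ε * (Y i ω ^ 2 - s)) := fun i ω => by
    simp only [Z, mul_assoc]
  have hZint : ∀ i, Integrable (fun ω => Real.exp (l * Z i ω)) μ := by
    intro i
    simp only [hexp]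
    rw [← (hY i).map_eq] at hint
    exact hint.comp_aemeasurable (hY i).aemeasurable
  have hZmgf : ∀ i, mgf (Z i) μ l ≤ Real.exp (q ^ 2 / 8) := by
    intro i
    have h1 : mgf (Z i) μ l = ∫ x, Real.exp (l * ε * (x ^ 2 - s)) ∂(gaussianReal 0 s) := by
      simp only [mgf, hexp]
      exact (hY i).integral_comp (f := fun x => Real.exp (l * ε * (x ^ 2 - s))) (by fun_prop)
    rw [h1]
    refine hmgf.trans (Real.exp_le_exp.2 ?_)
    calc 2 * (l * ε) ^ 2 * (s : ℝ) ^ 2 = 2 * (l * s) ^ 2 * ε ^ 2 := by ring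
      _ ≤ 2 * (q / 4) ^ 2 := by rw [hεsq, mul_one]; gcongr
      _ = q ^ 2 / 8 := by ring
  have hsum : ∀ ω, (∑ i, Z i) ω = ε * ∑ i, (Y i ω ^ 2 - s) := fun ω => by
    simp only [Finset.sum_apply, Z, Finset.mul_sum]
  have hsumint : Integrable (fun ω => Real.exp (l * (∑ i, Z i) ω)) μ := by
    -- Otherwise the moment generating function would take its junk value `0`.
    by_contra hnot
    have h0 := mgf_undef hnot
    rw [hZind.mgf_sum₀ hZm] at h0
    exact (Finset.prod_pos fun i _ => mgf_pos (hZint i)).ne' h0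
  have hcher := measure_ge_le_exp_mul_mgf (16 * σ * q * n) hl0 hsumint
  simp only [hsum] at hcher
  refine hcher.trans ?_
  rw [hZind.mgf_sum₀ hZm]
  calc Real.exp (-l * (16 * σ * q * n)) * ∏ i, mgf (Z i) μ l
      ≤ Real.exp (-l * (16 * σ * q * n)) * ∏ _i : Fin n, Real.exp (q ^ 2 / 8) := by
        gcongr with i
        · exact fun i _ => mgf_nonneg
        · exact hZmgf i
    _ = Real.exp (-(4 * p) + p / 8) := by
        rw [Finset.prod_const, Finset.card_univ, Fintype.card_fin, ← Real.exp_nat_mul,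
          ← Real.exp_add, ← hq2]
        congr 1
        rw [show -l * (16 * σ * q * n) = -(16 * (l * σ) * q * n) by ring, hlσ]
        ring
    _ ≤ Real.exp (-(3 * p)) := by
        refine Real.exp_le_exp.2 ?_
        have : (0 : ℝ) ≤ p := Nat.cast_nonneg _
        linarith

/-! ### Concentration of the sample covariance matrix -/

theorem hasLaw_inner_multivariateGaussian {Ω : Type*} [MeasurableSpace Ω] {μ : Measure Ω} {p : ℕ}
    {Sig : Mat p} (hSig : Sig.PosSemidef) {X : Ω → EuclideanSpace ℝ (Fin p)}
    (hX : HasLaw X (multivariateGaussian 0 Sig) μ) (c : EuclideanSpace ℝ (Fin p)) :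
    HasLaw (fun ω => inner ℝ c (X ω))
      (gaussianReal 0 (inner ℝ (toEuclideanCLM (𝕜 := ℝ) Sig c) c).toNNReal) μ := by
  have hmap : HasLaw (innerSL ℝ c)
      (gaussianReal 0 (inner ℝ (toEuclideanCLM (𝕜 := ℝ) Sig c) c).toNNReal)
      (multivariateGaussian 0 Sig) := by
    refine ⟨by fun_prop, ?_⟩
    rw [IsGaussian.map_eq_gaussianReal,
      (innerSL ℝ c).integral_comp_id_comm IsGaussian.integrable_id]
    have hvar : Var[innerSL ℝ c; multivariateGaussian 0 Sig]
        = inner ℝ (toEuclideanCLM (𝕜 := ℝ) Sig c) c := by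
      have h1 := covarianceBilin_self (μ := multivariateGaussian 0 Sig) IsGaussian.memLp_two_id c
      rw [covarianceBilin_multivariateGaussian hSig] at h1
      rw [real_inner_comm, inner_toEuclideanCLM, h1]
      rfl
    rw [hvar, integral_id_multivariateGaussian, map_zero]
  exact hmap.comp hX

theorem toEuclideanCLM_isSymmetric {p : ℕ} {A : Mat p} (hA : A.IsHermitian) :
    ((toEuclideanCLM (𝕜 := ℝ) A : EuclideanSpace ℝ (Fin p) →L[ℝ] EuclideanSpace ℝ (Fin p)) :
      EuclideanSpace ℝ (Fin p) →ₗ[ℝ] EuclideanSpace ℝ (Fin p)).IsSymmetric :=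
  Matrix.isSymmetric_toEuclideanLin_iff.2 hA

theorem isHermitian_sampleCov {p n : ℕ} (x : Fin n → EuclideanSpace ℝ (Fin p)) :
    (sampleCov x).IsHermitian := by
  ext i j
  simp [sampleCov, Matrix.sum_apply, Matrix.vecMulVec_apply, mul_comm]

theorem inner_sampleCov {p n : ℕ} (x : Fin n → EuclideanSpace ℝ (Fin p))
    (c : EuclideanSpace ℝ (Fin p)) :
    inner ℝ (toEuclideanCLM (𝕜 := ℝ) (sampleCov x) c) c
      = (1 / (n : ℝ)) * ∑ i, inner ℝ c (x i) ^ 2 := by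
  rw [real_inner_comm, inner_toEuclideanCLM]
  simp only [sampleCov, Matrix.smul_mulVec, dotProduct_smul, Matrix.sum_mulVec, dotProduct_sum,
    smul_eq_mul, Matrix.vecMulVec_mulVec]
  congr 1
  refine Finset.sum_congr rfl fun i _ => ?_
  simp only [dotProduct, PiLp.inner_apply]
  simp [mul_comm, sq, Finset.mul_sum]

/-- The deviation of the sample covariance in spectral norm: a union bound over the `5 ^ p` points
of a net, where `5 ≤ exp 2` leaves `exp (-p)` from the rate `3 p`. The set is not claimed to be
measurable, so this bounds its outer measure. -/
theorem measureReal_specNorm_sampleCov_sub_gt_le {Ω : Type*} [MeasurableSpace Ω] {μ : Measure Ω}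
    [IsProbabilityMeasure μ] {p n : ℕ} (hp : 0 < p) (hpn : p ≤ n) {Sig : Mat p} (hSig : Sig.PosDef)
    {X : Fin n → Ω → EuclideanSpace ℝ (Fin p)} (hind : iIndepFun X μ)
    (hX : ∀ i, HasLaw (X i) (multivariateGaussian 0 Sig) μ) :
    μ.real {ω | 512 * specNorm Sig * Real.sqrt (p / n) < specNorm (sampleCov (fun i => X i ω) - Sig)}
      ≤ 2 * Real.exp (-(p : ℝ)) := by
  have hn : (0 : ℝ) < n := by exact_mod_cast hp.trans_le hpn
  have hσ : 0 < specNorm Sig := by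
    refine norm_pos_iff.2 fun h0 => ?_
    have h1 : Sig = 0 := by simpa using h0
    have := hSig.diag_pos (i := ⟨0, hp⟩)
    simp [h1] at this
  obtain ⟨N, hcard, hN1, hN⟩ := exists_sphere_net (EuclideanSpace ℝ (Fin p))
  rw [finrank_euclideanSpace_fin] at hcard
  let v : EuclideanSpace ℝ (Fin p) → NNReal := fun c =>
    (inner ℝ (toEuclideanCLM (𝕜 := ℝ) Sig c) c).toNNReal
  have hvc : ∀ c, (v c : ℝ) = inner ℝ (toEuclideanCLM (𝕜 := ℝ) Sig c) c := fun c => by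
    refine Real.coe_toNNReal _ ?_
    rw [real_inner_comm, inner_toEuclideanCLM]
    simpa using hSig.posSemidef.dotProduct_mulVec_nonneg c.ofLp
  have hvσ : ∀ c ∈ N, (v c : ℝ) ≤ specNorm Sig := fun c hc => by
    rw [hvc]
    refine (real_inner_le_norm _ _).trans ?_
    rw [hN1 c hc, mul_one]
    simpa [hN1 c hc, specNorm] using (toEuclideanCLM (𝕜 := ℝ) Sig).le_opNorm c
  let B : ℝ → EuclideanSpace ℝ (Fin p) → Set Ω := fun ε c =>
    {ω | 16 * specNorm Sig * Real.sqrt (p / n) * n ≤ ε * ∑ i, (inner ℝ c (X i ω) ^ 2 - v c)}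
  have hB : ∀ ε, |ε| = 1 → ∀ c ∈ N, μ.real (B ε c) ≤ Real.exp (-(3 * p)) := fun ε hε c hc =>
    measureReal_signed_sum_sq_ge_le hp hpn
      (hind.comp (fun _ x => inner ℝ c x) fun _ => by fun_prop)
      (fun i => hasLaw_inner_multivariateGaussian hSig.posSemidef (hX i) c) hσ (hvσ c hc) hε
  have hsub : {ω | 512 * specNorm Sig * Real.sqrt (p / n)
      < specNorm (sampleCov (fun i => X i ω) - Sig)} ⊆ ⋃ c ∈ N, (B 1 c ∪ B (-1) c) := by
    intro ω hω
    by_contra hcon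
    simp only [Set.mem_iUnion, Set.mem_union, not_exists, not_or, B, Set.mem_ofPred_eq, not_le]
      at hcon
    rw [Set.mem_ofPred_eq] at hω
    refine absurd hω (not_lt.2 ?_)
    rw [show 512 * specNorm Sig * Real.sqrt (p / n) = 32 * (16 * specNorm Sig * Real.sqrt (p / n)) by
      ring]
    refine norm_le_of_sphere_net (toEuclideanCLM_isSymmetric
      ((isHermitian_sampleCov _).sub hSig.isHermitian)) hN1 hN (by positivity) fun c hc => ?_
    obtain ⟨h1, h2⟩ := hcon c hc
    have h3 : inner ℝ (toEuclideanCLM (𝕜 := ℝ) (sampleCov (fun i => X i ω) - Sig) c) c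
        = (∑ i, (inner ℝ c (X i ω) ^ 2 - (v c : ℝ))) / n := by
      rw [map_sub, _root_.sub_apply, inner_sub_left, inner_sampleCov, ← hvc,
        Finset.sum_sub_distrib, Finset.sum_const, Finset.card_univ, Fintype.card_fin,
        nsmul_eq_mul]
      field_simp
    rw [h3, abs_le, le_div_iff₀ hn, div_le_iff₀ hn]
    constructor <;> linarith
  have h5 : (5 : ℝ) ^ p ≤ Real.exp (2 * p) := by
    rw [mul_comm, Real.exp_nat_mul]
    refine pow_le_pow_left₀ (by norm_num) ?_ _
    have := Real.quadratic_le_exp_of_nonneg (show (0 : ℝ) ≤ 2 by norm_num)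
    linarith
  calc _ ≤ μ.real (⋃ c ∈ N, (B 1 c ∪ B (-1) c)) := measureReal_mono hsub (measure_ne_top _ _)
    _ ≤ ∑ c ∈ N, μ.real (B 1 c ∪ B (-1) c) := measureReal_biUnion_finset_le _ _
    _ ≤ ∑ _c ∈ N, 2 * Real.exp (-(3 * p)) := by
        refine Finset.sum_le_sum fun c hc => (measureReal_union_le _ _).trans ?_
        linarith [hB 1 (by simp) c hc, hB (-1) (by simp) c hc]
    _ = N.card * (2 * Real.exp (-(3 * p))) := by rw [Finset.sum_const, nsmul_eq_mul]
    _ ≤ Real.exp (2 * p) * (2 * Real.exp (-(3 * p))) := by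
        gcongr
        refine le_trans ?_ h5
        exact_mod_cast hcard
    _ = 2 * Real.exp (-(p : ℝ)) := by
        rw [mul_left_comm, ← Real.exp_add]
        ring_nf

end LatentGGM

theorem theorem6 :
    ∃ c₂ > (0 : ℝ), ∃ c₃ > (0 : ℝ),
      ∀ (p r n : ℕ) (S Lstar : LatentGGM.Mat p),
        S.PosDef → Lstar.PosSemidef → Lstar.rank ≤ r → p ≤ n →
      ∀ {Ω : Type*} [MeasurableSpace Ω] (μ : Measure Ω) [IsProbabilityMeasure μ]
        (X : Fin n → Ω → EuclideanSpace ℝ (Fin p)),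
        iIndepFun X μ → (∀ i, HasLaw (X i) (multivariateGaussian 0 (S + Lstar)⁻¹) μ) →
      ∃ E : Set Ω, MeasurableSet E ∧ 1 - 2 * Real.exp (-(p : ℝ)) ≤ μ.real E ∧ ∀ ω ∈ E,
        (∀ (η : ℝ) (L : ℕ → LatentGGM.Mat p), 0 < η →
          LatentGGM.IsEPRun S (LatentGGM.sampleCov fun i => X i ω) r η L →
          ∀ t : ℕ,
            LatentGGM.frobNorm (LatentGGM.proj (LatentGGM.epSubspace Lstar L t)
                (LatentGGM.grad S (LatentGGM.sampleCov fun i => X i ω) Lstar))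
              ≤ c₂ * LatentGGM.specNorm (S + Lstar)⁻¹ * Real.sqrt ((r : ℝ) * p / n)) ∧
        (∀ (cT cH : ℝ) (T H : LatentGGM.Mat p → Submodule ℝ (LatentGGM.Mat p))
            (η : ℝ) (L : ℕ → LatentGGM.Mat p),
          1 < cT → 0 < cH → cH < 1 →
          LatentGGM.IsApproxTail cT r T → LatentGGM.IsApproxHead cH (2 * r) H → 0 < η →
          LatentGGM.IsAPRun S (LatentGGM.sampleCov fun i => X i ω) η T H L →
          ∀ t : ℕ,
            LatentGGM.frobNorm (LatentGGM.proj (LatentGGM.apSubspace S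
                  (LatentGGM.sampleCov fun i => X i ω) H L t)
                (LatentGGM.grad S (LatentGGM.sampleCov fun i => X i ω) Lstar))
              ≤ c₃ * LatentGGM.specNorm (S + Lstar)⁻¹ * Real.sqrt ((r : ℝ) * p / n)) := by
  refine ⟨Real.sqrt 3 * 512, by positivity, Real.sqrt 2 * 512, by positivity, ?_⟩
  intro p r n S Lstar hS hLstar hrank hpn Ω _ μ _ X hind hX
  rcases Nat.eq_zero_or_pos p with rfl | hp
  · -- All `0 × 0` matrices vanish, and the claimed probability is negative.
    refine ⟨Set.univ, MeasurableSet.univ, by simp, fun ω _ => ?_⟩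
    simp [LatentGGM.frobNorm]
  set Sig := (S + Lstar)⁻¹
  have hSig : Sig.PosDef := (hS.add_posSemidef hLstar).inv
  set bad : Set Ω := {ω | 512 * LatentGGM.specNorm Sig * Real.sqrt (p / n)
    < LatentGGM.specNorm (LatentGGM.sampleCov (fun i => X i ω) - Sig)} with hbad
  have hprob : μ.real bad ≤ 2 * Real.exp (-(p : ℝ)) :=
    LatentGGM.measureReal_specNorm_sampleCov_sub_gt_le hp hpn hSig hind hX
  -- The `X i` are only almost everywhere measurable, hence the measurable hull.
  refine ⟨(toMeasurable μ bad)ᶜ, (measurableSet_toMeasurable μ bad).compl, ?_, fun ω hω => ?_⟩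
  · rw [probReal_compl_eq_one_sub (measurableSet_toMeasurable μ bad), measureReal_def,
      measure_toMeasurable, ← measureReal_def]
    linarith
  have hgood : LatentGGM.specNorm (LatentGGM.sampleCov (fun i => X i ω) - Sig)
      ≤ 512 * LatentGGM.specNorm Sig * Real.sqrt (p / n) :=
    not_lt.1 fun h => hω (subset_toMeasurable μ bad h)
  have hgrad : LatentGGM.grad S (LatentGGM.sampleCov fun i => X i ω) Lstar
      = LatentGGM.sampleCov (fun i => X i ω) - Sig := by
    rw [LatentGGM.grad, neg_add_eq_sub]
  have hbound : ∀ (m : ℕ) (U : Submodule ℝ (LatentGGM.Mat p)),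
      (∀ M ∈ U, M.rank ≤ m * r) →
      LatentGGM.frobNorm (LatentGGM.proj U
          (LatentGGM.grad S (LatentGGM.sampleCov fun i => X i ω) Lstar))
        ≤ Real.sqrt m * 512 * LatentGGM.specNorm Sig * Real.sqrt ((r : ℝ) * p / n) := by
    intro m U hU
    rw [hgrad]
    calc _ ≤ Real.sqrt ((m * r : ℕ) : ℝ)
          * LatentGGM.specNorm (LatentGGM.sampleCov (fun i => X i ω) - Sig) :=
          LatentGGM.frobNorm_proj_le hU _
      _ ≤ Real.sqrt ((m * r : ℕ) : ℝ) * (512 * LatentGGM.specNorm Sig * Real.sqrt (p / n)) := by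
          gcongr
      _ = _ := by
          rw [Nat.cast_mul, Real.sqrt_mul (Nat.cast_nonneg _), mul_div_assoc,
            Real.sqrt_mul (Nat.cast_nonneg _)]
          ring
  constructor
  · intro η L _ hL t
    exact hbound 3 _ fun M hM => LatentGGM.rank_le_of_mem_epSubspace hrank hL.rank_le t hM
  · intro cT cH T H η L _ _ _ _ hH _ _ t
    exact hbound 2 _ fun M hM => (hH _).1.rank_le hM
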